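/- For nonzero integers $m,n$ let $B(m,n)=\langle a,b : a^{-1}b^{m}a=b^{n}\rangle$, and let $|\cdot|_a\colon B(m,n)\to\mathbb Z$ be the surjective homomorphism with $a\mapsto 1$, $b\mapsto 0$ (the exponent sum of $a$), whose kernel is the normal closure of $b$. For homomorphisms $\phi,\psi\colon G\to G$ of a group $G$, the coincidence Reidemeister number $R(\phi,\psi)$ is the number of equivalence classes of the relation on $G$ given by $\alpha\sim\psi(\tau)\,\alpha\,\phi(\tau)^{-1}$ $(\alpha,\tau\in G)$. **Theorem 7.1.** Let $m,n$ be integers with $|m|\neq|n|$ and $mn\neq 0$, and let $\phi,\psi\colon B(m,n)\to B(m,n)$ be injective endomorphisms. Then $\phi$ and $\psi$ both induce the identity on the quotient $\mathbb Z$, that is, $|\phi(x)|_a=|x|_a=|\psi(x)|_a$ for all $x\in B(m,n)$, and $R(\phi,\psi)=\infty$. -/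

import Mathlib

namespace BaumslagSolitar

/-- The word `a⁻¹ b ^ m a (b ^ n)⁻¹` in the free group on `a = of 0` and `b = of 1`. -/
def relator (m n : ℤ) : FreeGroup (Fin 2) :=
  (FreeGroup.of 0)⁻¹ * FreeGroup.of 1 ^ m * FreeGroup.of 0 * (FreeGroup.of 1 ^ n)⁻¹

/-- The group `B(m, n) = ⟨a, b : a⁻¹ b ^ m a = b ^ n⟩`. -/
abbrev B (m n : ℤ) : Type := PresentedGroup {relator m n}

/-- The values of the exponent sum of `a` on the generators: `a ↦ 1` and `b ↦ 0`, with `ℤ`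
written multiplicatively. -/
def genExpSum : Fin 2 → Multiplicative ℤ := ![Multiplicative.ofAdd 1, 1]

theorem lift_genExpSum_eq_one (m n : ℤ) :
    ∀ r ∈ ({relator m n} : Set (FreeGroup (Fin 2))), FreeGroup.lift genExpSum r = 1 := by
  rintro r rfl
  simp [relator, genExpSum]

/-- The projection `B(m, n) → ℤ` onto the quotient by the normal closure of `b`: it takes the
class of a word to the sum of the exponents of `a` in it. -/
def expSum (m n : ℤ) : B m n →* Multiplicative ℤ :=
  PresentedGroup.toGroup (lift_genExpSum_eq_one m n)

end BaumslagSolitar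

namespace Coincidence

variable {K G : Type*} [Group K] [Group G]

/-- The relation on `G` given by a pair of homomorphisms `f g : K →* G`:
`α ∼ g τ * α * (f τ)⁻¹` for `τ` in `K`. -/
def reidemeisterSetoid (f g : K →* G) : Setoid G where
  r α β := ∃ τ : K, β = g τ * α * (f τ)⁻¹
  iseqv :=
    { refl := fun α => ⟨1, by simp⟩
      symm := by
        rintro α β ⟨τ, rfl⟩
        exact ⟨τ⁻¹, by simp [mul_assoc]⟩
      trans := by
        rintro α β γ ⟨σ, rfl⟩ ⟨τ, rfl⟩
        exact ⟨τ * σ, by simp [mul_assoc]⟩ }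

/-- The coincidence Reidemeister number `R(f, g)`: the number, possibly `⊤`, of classes. -/
noncomputable def reidemeisterNumber (f g : K →* G) : ℕ∞ :=
  ENat.card (Quotient (reidemeisterSetoid f g))

end Coincidence

/-!
Write `α = φ a` and `β = φ b`, so that `α⁻¹ * β ^ m * α = β ^ n`. The group `B(m, n)` is an HNN
extension of `ℤ = ⟨b⟩`, and the stable length `ℓ x` of an element (the growth rate of the number of
stable letters in its powers) is invariant under conjugation and satisfies `ℓ (x ^ k) = |k| * ℓ x`.
Since `β ^ m` and `β ^ n` are conjugate and `|m| ≠ |n|`, the stable length of `β` vanishes, which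
by cyclic reduction forces `β` to be conjugate to a power of `b`. Let `a` act on `ℚ` by
multiplication by `m / n` and `b` by translation by `1`: then `β ≠ 1` acts by a non-trivial
translation, and the relation says that the linear part `(m / n) ^ |α|_a` of `α` is `m / n`, hence
`|α|_a = 1`. Consequently `|·|_a` is constant on the Reidemeister classes of `φ` and `ψ`, and it
takes infinitely many values.
-/

section StableLength

open Filter Topology

variable {G : Type*} [Group G] (ℓ : GroupSeminorm G)

theorem subadditive_seminorm_pow (x : G) : Subadditive fun k => ℓ (x ^ k) := fun j k => by
  simpa only [pow_add] using map_mul_le_add ℓ (x ^ j) (x ^ k)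

/-- The stable (translation) length of `x`: the limit of `ℓ (x ^ k) / k` as `k → ∞`. -/
noncomputable def stableLength (x : G) : ℝ :=
  (subadditive_seminorm_pow ℓ x).lim

theorem tendsto_seminorm_pow_div (x : G) :
    Tendsto (fun k : ℕ => ℓ (x ^ k) / k) atTop (𝓝 (stableLength ℓ x)) :=
  (subadditive_seminorm_pow ℓ x).tendsto_lim
    ⟨0, by rintro _ ⟨k, rfl⟩; exact div_nonneg (apply_nonneg ℓ _) k.cast_nonneg⟩

theorem stableLength_conj_le (g x : G) : stableLength ℓ (g * x * g⁻¹) ≤ stableLength ℓ x := by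
  have hlim : Tendsto (fun k : ℕ => ℓ (x ^ k) / k + 2 * ℓ g / k) atTop
      (𝓝 (stableLength ℓ x)) := by
    simpa using (tendsto_seminorm_pow_div ℓ x).add
      (tendsto_const_div_atTop_nhds_zero_nat (2 * ℓ g))
  refine le_of_tendsto_of_tendsto' (tendsto_seminorm_pow_div ℓ _) hlim fun k => ?_
  have hconj : ℓ ((g * x * g⁻¹) ^ k) ≤ ℓ (x ^ k) + 2 * ℓ g := by
    calc ℓ ((g * x * g⁻¹) ^ k) = ℓ (g * x ^ k * g⁻¹) := by rw [conj_pow]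
      _ ≤ ℓ g + ℓ (x ^ k) + ℓ g⁻¹ := by
        grw [map_mul_le_add, map_mul_le_add]
      _ = ℓ (x ^ k) + 2 * ℓ g := by rw [map_inv_eq_map]; ring
  rw [← add_div]
  gcongr

theorem stableLength_eq_of_isConj {x y : G} (h : IsConj x y) :
    stableLength ℓ x = stableLength ℓ y := by
  obtain ⟨g, rfl⟩ := isConj_iff.1 h
  refine le_antisymm ?_ (stableLength_conj_le ℓ g x)
  simpa [mul_assoc] using stableLength_conj_le ℓ g⁻¹ (g * x * g⁻¹)

theorem stableLength_pow (x : G) (n : ℕ) : stableLength ℓ (x ^ n) = n * stableLength ℓ x := by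
  refine tendsto_nhds_unique (tendsto_seminorm_pow_div ℓ (x ^ n)) ?_
  rcases Nat.eq_zero_or_pos n with rfl | hn
  · simp
  have hsub := (tendsto_seminorm_pow_div ℓ x).comp (tendsto_id.const_mul_atTop' hn)
  refine (hsub.const_mul (n : ℝ)).congr fun k => ?_
  simp only [Function.comp_apply, id, ← pow_mul, Nat.cast_mul]
  field_simp

theorem stableLength_inv (x : G) : stableLength ℓ x⁻¹ = stableLength ℓ x := by
  simp only [stableLength, inv_pow, map_inv_eq_map]

theorem stableLength_zpow (x : G) (p : ℤ) :
    stableLength ℓ (x ^ p) = |(p : ℝ)| * stableLength ℓ x := by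
  obtain ⟨k, rfl | rfl⟩ := p.eq_nat_or_neg
  · simp [stableLength_pow]
  · simp [stableLength_pow, stableLength_inv]

theorem stableLength_eq_zero_of_isConj_zpow {x : G} {p q : ℤ} (hpq : |p| ≠ |q|)
    (h : IsConj (x ^ p) (x ^ q)) : stableLength ℓ x = 0 := by
  have heq := stableLength_eq_of_isConj ℓ h
  rw [stableLength_zpow, stableLength_zpow] at heq
  exact (mul_eq_mul_right_iff.1 heq).resolve_left (mod_cast hpq)

end StableLength

section HNNExtension

open Filter HNNExtension HNNExtension.NormalWord

variable {G : Type*} [Group G] {A B : Subgroup G} (φ : A ≃* B)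

/-- The element `t ^ u₁ * g₁ * ⋯ * t ^ uₖ * gₖ` of the HNN extension spelled by a list of
syllables `(uᵢ, gᵢ)`. -/
def syllableProd (l : List (ℤˣ × G)) : HNNExtension G A B φ :=
  (l.map fun s => t ^ (s.1 : ℤ) * of s.2).prod

@[simp]
theorem syllableProd_nil : syllableProd φ [] = 1 := rfl

@[simp]
theorem syllableProd_cons (s : ℤˣ × G) (l : List (ℤˣ × G)) :
    syllableProd φ (s :: l) = t ^ (s.1 : ℤ) * of s.2 * syllableProd φ l := by
  simp [syllableProd]

@[simp]
theorem syllableProd_append (l l' : List (ℤˣ × G)) :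
    syllableProd φ (l ++ l') = syllableProd φ l * syllableProd φ l' := by
  simp [syllableProd]

theorem syllableProd_flatten_replicate (l : List (ℤˣ × G)) (k : ℕ) :
    syllableProd φ (List.replicate k l).flatten = syllableProd φ l ^ k := by
  induction k with
  | zero => simp
  | succ k ih => simp [List.replicate_succ, ih, pow_succ']

/-- A list of syllables is reduced if it has no subword `t ^ u * g * t ^ (-u)` which the defining
relations of the HNN extension shorten; this is the condition in `ReducedWord`. -/
abbrev IsReducedSyllables (A B : Subgroup G) (l : List (ℤˣ × G)) : Prop :=
  l.IsChain fun r s => r.2 ∈ toSubgroup A B r.1 → r.1 = s.1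

variable {φ} in
theorem exists_eq_of_mul_syllableProd (x : HNNExtension G A B φ) :
    ∃ (g : G) (l : List (ℤˣ × G)), IsReducedSyllables A B l ∧ x = of g * syllableProd φ l := by
  let w := NormalWord.equiv φ (Classical.arbitrary (TransversalPair G A B)) x
  exact ⟨w.head, w.toList, w.chain, ((NormalWord.equiv φ _).symm_apply_apply x).symm⟩

variable {φ}

/-- The number of stable letters `t ^ ±1` in the normal form of `x`. -/
noncomputable def stableLetterCount (x : HNNExtension G A B φ) : ℕ :=
  (x • (empty : NormalWord (Classical.arbitrary (TransversalPair G A B)))).toList.length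

theorem stableLetterCount_of_mul_syllableProd (g : G) {l : List (ℤˣ × G)}
    (hl : IsReducedSyllables A B l) :
    stableLetterCount (of g * syllableProd φ l) = l.length := by
  obtain ⟨w, hw, hmap, -⟩ :=
    ReducedWord.exists_normalWord_prod_eq φ (Classical.arbitrary _) ⟨g, l, hl⟩
  have hprod : of g * syllableProd φ l = w.prod φ := hw.symm
  rw [stableLetterCount, hprod, prod_smul_empty]
  simpa using congrArg List.length hmap

theorem stableLetterCount_syllableProd {l : List (ℤˣ × G)} (hl : IsReducedSyllables A B l) :
    stableLetterCount (syllableProd φ l) = l.length := by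
  simpa using stableLetterCount_of_mul_syllableProd 1 hl

theorem stableLetterCount_of_mul (g : G) (x : HNNExtension G A B φ) :
    stableLetterCount (of g * x) = stableLetterCount x := by
  rw [stableLetterCount, mul_smul, of_smul_eq_smul, group_smul_toList, stableLetterCount]

theorem stableLetterCount_of (g : G) : stableLetterCount (of g : HNNExtension G A B φ) = 0 := by
  simpa using stableLetterCount_of_mul_syllableProd g List.isChain_nil

variable (φ) in
theorem length_unitsSMul_le {d : TransversalPair G A B} (u : ℤˣ) (w : NormalWord d) :
    (unitsSMul φ u w).toList.length ≤ w.toList.length + 1 := by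
  rw [unitsSMul]
  split_ifs with hcancel
  · cases w using consRecOn with
    | ofGroup g => simp [Cancels] at hcancel
    | cons g u' w hg hw =>
      simp only [unitsSMulWithCancel, consRecOn_cons, group_smul_toList, cons_toList,
        List.length_cons]
      omega
  · simp

theorem stableLetterCount_t_zpow_mul_le (u : ℤˣ) (x : HNNExtension G A B φ) :
    stableLetterCount (t ^ (u : ℤ) * x) ≤ stableLetterCount x + 1 := by
  rw [stableLetterCount, mul_smul, t_pow_smul_eq_unitsSMul]
  exact length_unitsSMul_le φ u _

theorem stableLetterCount_syllableProd_mul_le (l : List (ℤˣ × G)) (x : HNNExtension G A B φ) :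
    stableLetterCount (syllableProd φ l * x) ≤ l.length + stableLetterCount x := by
  induction l with
  | nil => simp
  | cons s l ih =>
    have hs := stableLetterCount_t_zpow_mul_le s.1 (of s.2 * (syllableProd φ l * x))
    rw [stableLetterCount_of_mul] at hs
    simp only [syllableProd_cons, mul_assoc, List.length_cons]
    omega

theorem stableLetterCount_mul_le (x y : HNNExtension G A B φ) :
    stableLetterCount (x * y) ≤ stableLetterCount x + stableLetterCount y := by
  obtain ⟨g, l, hl, rfl⟩ := exists_eq_of_mul_syllableProd x
  rw [stableLetterCount_of_mul_syllableProd g hl, mul_assoc, stableLetterCount_of_mul]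
  exact stableLetterCount_syllableProd_mul_le l y

theorem stableLetterCount_syllableProd_inv_le (l : List (ℤˣ × G)) :
    stableLetterCount (syllableProd φ l)⁻¹ ≤ l.length := by
  induction l with
  | nil => rw [syllableProd_nil, inv_one, ← map_one of, stableLetterCount_of, List.length_nil]
  | cons s l ih =>
    have hinv : (syllableProd φ (s :: l))⁻¹ =
        (syllableProd φ l)⁻¹ * (of s.2⁻¹ * (t ^ ((-s.1 : ℤˣ) : ℤ) * of 1)) := by
      simp [mul_assoc]
    have hs := stableLetterCount_t_zpow_mul_le (φ := φ) (-s.1) (of 1)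
    rw [stableLetterCount_of] at hs
    have hmul := stableLetterCount_mul_le (syllableProd φ l)⁻¹
      (of s.2⁻¹ * (t ^ ((-s.1 : ℤˣ) : ℤ) * of 1))
    rw [stableLetterCount_of_mul] at hmul
    rw [hinv, List.length_cons]
    omega

theorem stableLetterCount_inv_le (x : HNNExtension G A B φ) :
    stableLetterCount x⁻¹ ≤ stableLetterCount x := by
  obtain ⟨g, l, hl, rfl⟩ := exists_eq_of_mul_syllableProd x
  calc stableLetterCount (of g * syllableProd φ l)⁻¹
      = stableLetterCount ((syllableProd φ l)⁻¹ * of g⁻¹) := by rw [mul_inv_rev, map_inv]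
    _ ≤ stableLetterCount (syllableProd φ l)⁻¹ + 0 := by
      grw [stableLetterCount_mul_le, stableLetterCount_of]
    _ ≤ l.length := stableLetterCount_syllableProd_inv_le l
    _ = _ := (stableLetterCount_of_mul_syllableProd g hl).symm

variable (φ) in
/-- The number of stable letters in the normal form, as a length function. -/
noncomputable def stableLetterSeminorm : GroupSeminorm (HNNExtension G A B φ) where
  toFun x := stableLetterCount x
  map_one' := by rw [← map_one of, stableLetterCount_of, Nat.cast_zero]
  mul_le' x y := mod_cast stableLetterCount_mul_le x y
  inv' x := by
    have h := stableLetterCount_inv_le x⁻¹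
    rw [inv_inv] at h
    exact congrArg Nat.cast ((stableLetterCount_inv_le x).antisymm h)

theorem isReducedSyllables_flatten_replicate {l : List (ℤˣ × G)} (hne : l ≠ [])
    (hl : IsReducedSyllables A B (l ++ l)) (k : ℕ) :
    IsReducedSyllables A B (List.replicate k l).flatten := by
  obtain ⟨hchain, -, hjoin⟩ := List.isChain_append.1 hl
  rw [IsReducedSyllables,
    List.isChain_flatten fun h => hne (List.eq_of_mem_replicate h).symm]
  exact ⟨fun l' hl' => List.eq_of_mem_replicate hl' ▸ hchain,
    List.isChain_replicate_of_rel k hjoin⟩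

theorem stableLength_syllableProd {l : List (ℤˣ × G)} (hne : l ≠ [])
    (hl : IsReducedSyllables A B (l ++ l)) :
    stableLength (stableLetterSeminorm φ) (syllableProd φ l) = l.length := by
  refine tendsto_nhds_unique (tendsto_seminorm_pow_div _ _) ?_
  refine tendsto_const_nhds.congr' ?_
  filter_upwards [eventually_ne_atTop 0] with k hk
  have hcount : stableLetterSeminorm φ (syllableProd φ l ^ k) = ((k * l.length : ℕ) : ℝ) := by
    rw [← syllableProd_flatten_replicate]
    refine congrArg Nat.cast ((stableLetterCount_syllableProd
      (isReducedSyllables_flatten_replicate hne hl k)).trans ?_)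
    simp
  rw [hcount, Nat.cast_mul]
  field_simp

theorem exists_t_zpow_mul_of_mul_zpow_neg_eq_of {u : ℤˣ} {a : G} (ha : a ∈ toSubgroup A B u) :
    ∃ b : G, (t ^ (u : ℤ) * of a * t ^ (-(u : ℤ)) : HNNExtension G A B φ) = of b := by
  rcases Int.units_eq_one_or u with rfl | rfl
  · exact ⟨φ ⟨a, ha⟩, by simpa using (equiv_eq_conj (φ := φ) ⟨a, ha⟩).symm⟩
  · exact ⟨φ.symm ⟨a, ha⟩, by simpa using (equiv_symm_eq_conj (φ := φ) ⟨a, ha⟩).symm⟩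

theorem eq_cons_concat_of_not_isReducedSyllables_append {l : List (ℤˣ × G)}
    (hl : IsReducedSyllables A B l) (hll : ¬ IsReducedSyllables A B (l ++ l)) :
    ∃ (u : ℤˣ) (b : G) (l' : List (ℤˣ × G)) (a : G),
      a ∈ toSubgroup A B u ∧ l = (-u, b) :: l' ++ [(u, a)] := by
  rcases List.eq_nil_or_concat' l with rfl | ⟨l₁, ⟨u, a⟩, rfl⟩
  · exact absurd hl hll
  rcases l₁ with _ | ⟨⟨v, b⟩, l'⟩
  · exact absurd (by simp [IsReducedSyllables]) hll
  have hjoin : a ∈ toSubgroup A B u ∧ u ≠ v := by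
    by_contra hc
    exact hll (List.isChain_append.2 ⟨hl, hl, by rw [List.getLast?_concat]; simpa using hc⟩)
  obtain rfl : v = -u := Int.units_ne_iff_eq_neg.1 hjoin.2.symm
  exact ⟨u, b, l', a, hjoin.1, rfl⟩

theorem exists_isConj_stableLetterCount_lt {l : List (ℤˣ × G)} (hl : IsReducedSyllables A B l)
    (hll : ¬ IsReducedSyllables A B (l ++ l)) :
    ∃ y, IsConj (syllableProd φ l) y ∧ stableLetterCount y < l.length := by
  obtain ⟨u, b, l', a, ha, rfl⟩ := eq_cons_concat_of_not_isReducedSyllables_append hl hll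
  obtain ⟨c, hc⟩ := exists_t_zpow_mul_of_mul_zpow_neg_eq_of ha
  refine ⟨of b * (syllableProd φ l' * of c), isConj_iff.2 ⟨t ^ (u : ℤ), ?_⟩, ?_⟩
  · rw [← hc]
    simp only [syllableProd_append, syllableProd_cons, syllableProd_nil, Units.val_neg]
    group
  · have hle := stableLetterCount_syllableProd_mul_le (φ := φ) l' (of c)
    rw [stableLetterCount_of] at hle
    simp only [stableLetterCount_of_mul, List.length_append, List.length_cons, List.length_nil]
    omega

theorem isReducedSyllables_concat_iff {l : List (ℤˣ × G)} {u : ℤˣ} {a b : G} :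
    IsReducedSyllables A B (l ++ [(u, a)]) ↔ IsReducedSyllables A B (l ++ [(u, b)]) := by
  simp [IsReducedSyllables, List.isChain_append]

theorem exists_isConj_of_or_isConj_syllableProd (x : HNNExtension G A B φ) :
    (∃ g : G, IsConj (of g) x) ∨
      ∃ l ≠ [], IsReducedSyllables A B (l ++ l) ∧ IsConj (syllableProd φ l) x := by
  -- A conjugate of `x` with the fewest stable letters is cyclically reduced.
  obtain ⟨y, hxy, hmin⟩ :=
    (measure stableLetterCount).wf.has_min {y | IsConj x y} ⟨x, .refl x⟩
  obtain ⟨g, l, hl, rfl⟩ := exists_eq_of_mul_syllableProd y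
  rcases List.eq_nil_or_concat' l with rfl | ⟨l', ⟨u, a⟩, rfl⟩
  · exact .inl ⟨g, by simpa using hxy.symm⟩
  have hl' : IsReducedSyllables A B (l' ++ [(u, a * g)]) := isReducedSyllables_concat_iff.1 hl
  have hconj : IsConj (syllableProd φ (l' ++ [(u, a * g)])) x :=
    (isConj_iff.2 ⟨of g, by simp [mul_assoc]⟩).trans hxy.symm
  refine .inr ⟨_, by simp, ?_, hconj⟩
  by_contra hll
  obtain ⟨z, hz, hlt⟩ := exists_isConj_stableLetterCount_lt hl' hll
  refine hmin z (hconj.symm.trans hz) (hlt.trans_eq ?_)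
  rw [stableLetterCount_of_mul_syllableProd g hl, List.length_append, List.length_append]
  rfl

theorem exists_isConj_of_of_stableLength_eq_zero {x : HNNExtension G A B φ}
    (hx : stableLength (stableLetterSeminorm φ) x = 0) : ∃ g : G, IsConj (of g) x := by
  refine (exists_isConj_of_or_isConj_syllableProd x).resolve_right ?_
  rintro ⟨l, hne, hl, hconj⟩
  rw [← stableLength_eq_of_isConj _ hconj, stableLength_syllableProd hne hl] at hx
  exact hne (List.length_eq_zero_iff.1 (mod_cast hx))

end HNNExtension

theorem eq_one_of_isConj_zpow {G H : Type*} [Group G] [CommGroup H] [IsMulTorsionFree H]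
    (f : G →* H) {x : G} {p q : ℤ} (hpq : p ≠ q) (h : IsConj (x ^ p) (x ^ q)) : f x = 1 := by
  have hpow : f x ^ p = f x ^ q := by simpa using isConj_iff_eq.1 (f.map_isConj h)
  refine (IsMulTorsionFree.zpow_eq_one_iff_left (sub_ne_zero.2 hpq)).1 ?_
  rw [zpow_sub, hpow, mul_inv_cancel]

theorem zpow_injective_of_abs_ne_one {K : Type*} [Field K] [LinearOrder K] [IsStrictOrderedRing K]
    {r : K} (hr0 : r ≠ 0) (hr1 : |r| ≠ 1) : Function.Injective fun k : ℤ => r ^ k :=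
  fun i j hij => zpow_right_injective₀ (abs_pos.2 hr0) hr1 <| by
    simpa only [abs_zpow] using congrArg abs hij

/-- The isomorphism of cyclic subgroups carrying `x` to the element `y` of the same order. -/
noncomputable def zpowersMulEquiv {G : Type*} [Group G] {x y : G} (h : orderOf x = orderOf y) :
    Subgroup.zpowers x ≃* Subgroup.zpowers y :=
  mulEquivOfOrderOfEq
    (g := ⟨x, Subgroup.mem_zpowers x⟩) (g' := ⟨y, Subgroup.mem_zpowers y⟩)
    (by rintro ⟨_, k, rfl⟩; exact ⟨k, rfl⟩) (by rintro ⟨_, k, rfl⟩; exact ⟨k, rfl⟩) (by simpa)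

theorem zpowersMulEquiv_zpow {G : Type*} [Group G] {x y : G} (h : orderOf x = orderOf y) (k : ℤ) :
    (zpowersMulEquiv h ⟨x ^ k, Subgroup.zpow_mem_zpowers x k⟩ : G) = y ^ k := by
  have hgen : zpowersMulEquiv h ⟨x, Subgroup.mem_zpowers x⟩ = ⟨y, Subgroup.mem_zpowers y⟩ :=
    mulEquivOfOrderOfEq_apply_gen ..
  have hpow := congrArg Subtype.val (map_zpow (zpowersMulEquiv h) ⟨x, Subgroup.mem_zpowers x⟩ k)
  rwa [hgen] at hpow

namespace BaumslagSolitar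

variable {m n : ℤ}

theorem inv_of_zero_mul_zpow_mul (m n : ℤ) :
    (PresentedGroup.of 0 : B m n)⁻¹ * PresentedGroup.of 1 ^ m * PresentedGroup.of 0 =
      PresentedGroup.of 1 ^ n :=
  mul_inv_eq_one.1 (PresentedGroup.one_of_mem (Set.mem_singleton (relator m n)))

@[simp]
theorem expSum_of_zero : expSum m n (PresentedGroup.of 0) = Multiplicative.ofAdd 1 :=
  PresentedGroup.toGroup.of _

@[simp]
theorem expSum_of_one : expSum m n (PresentedGroup.of 1) = 1 :=
  PresentedGroup.toGroup.of _

theorem expSum_surjective (m n : ℤ) : Function.Surjective (expSum m n) := fun k =>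
  ⟨PresentedGroup.of 0 ^ k.toAdd, by simp [← ofAdd_zsmul]⟩

theorem hom_ext {H : Type*} [Group H] {f g : B m n →* H}
    (h0 : f (PresentedGroup.of 0) = g (PresentedGroup.of 0))
    (h1 : f (PresentedGroup.of 1) = g (PresentedGroup.of 1)) : f = g :=
  PresentedGroup.ext (φ := f) (ψ := g) (Fin.forall_fin_two.2 ⟨h0, h1⟩)

section Lift

variable {H : Type*} [Group H] (a b : H) (h : a⁻¹ * b ^ m * a = b ^ n)

/-- The homomorphism out of `B(m, n)` given by two elements satisfying its relation. -/
def lift : B m n →* H :=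
  PresentedGroup.toGroup (f := ![a, b]) (by
    rintro r rfl
    simpa [relator, mul_inv_eq_one] using h)

@[simp]
theorem lift_of_zero : lift a b h (PresentedGroup.of 0) = a :=
  PresentedGroup.toGroup.of _

@[simp]
theorem lift_of_one : lift a b h (PresentedGroup.of 1) = b :=
  PresentedGroup.toGroup.of _

end Lift

theorem orderOf_ofAdd_eq (hm : m ≠ 0) (hn : n ≠ 0) :
    orderOf (Multiplicative.ofAdd m) = orderOf (Multiplicative.ofAdd n) := by
  rw [orderOf_eq_zero (not_isOfFinOrder_of_isMulTorsionFree (by simpa using hm)),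
    orderOf_eq_zero (not_isOfFinOrder_of_isMulTorsionFree (by simpa using hn))]

/-- The HNN extension of `ℤ` by the isomorphism `m ℤ ≃ n ℤ` taking `m` to `n`. -/
abbrev HNN (hm : m ≠ 0) (hn : n ≠ 0) : Type :=
  HNNExtension (Multiplicative ℤ) _ _ (zpowersMulEquiv (orderOf_ofAdd_eq hm hn))

section HNN

open HNNExtension

variable (hm : m ≠ 0) (hn : n ≠ 0)

/-- The map `a ↦ t⁻¹`, `b ↦ 1 ∈ ℤ`: the stable letter corresponds to the inverse of `a`. -/
noncomputable def toHNN : B m n →* HNN hm hn :=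
  lift t⁻¹ (of (Multiplicative.ofAdd 1)) (by
    have h := t_mul_of (φ := zpowersMulEquiv (orderOf_ofAdd_eq hm hn))
      ⟨_, Subgroup.zpow_mem_zpowers _ 1⟩
    rw [zpowersMulEquiv_zpow] at h
    simp only [zpow_one] at h
    simp only [← map_zpow, ← ofAdd_zsmul, smul_eq_mul, mul_one, inv_inv]
    rw [h, mul_inv_cancel_right])

/-- The map `t ↦ a⁻¹`, `k ↦ b ^ k` for `k ∈ ℤ`. -/
noncomputable def ofHNN : HNN hm hn →* B m n :=
  HNNExtension.lift (zpowersHom (B m n) (PresentedGroup.of 1)) (PresentedGroup.of 0)⁻¹ (by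
    rintro ⟨_, k, rfl⟩
    have hconj := (conj_zpow (a := (PresentedGroup.of 0 : B m n)⁻¹)
      (b := PresentedGroup.of 1 ^ m) (i := k)).symm
    rw [inv_inv, inv_of_zero_mul_zpow_mul] at hconj
    rw [← mul_inv_eq_iff_eq_mul, inv_inv]
    simpa [zpowersMulEquiv_zpow, ← zpow_mul, mul_comm k] using hconj)

/-- `B(m, n)` is the HNN extension of `ℤ` with associated subgroups `m ℤ` and `n ℤ`. -/
noncomputable def equivHNN : B m n ≃* HNN hm hn :=
  (toHNN hm hn).toMulEquiv (ofHNN hm hn)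
    (hom_ext (by simp [ofHNN, toHNN]) (by simp [ofHNN, toHNN]))
    (HNNExtension.hom_ext (MonoidHom.ext_mint (by simp [ofHNN, toHNN])) (by simp [ofHNN, toHNN]))

theorem equivHNN_symm_of (k : Multiplicative ℤ) :
    (equivHNN hm hn).symm (of k) = PresentedGroup.of 1 ^ k.toAdd := by
  simp [equivHNN, ofHNN]

end HNN

theorem exists_isConj_of_one_zpow (hm : m ≠ 0) (hn : n ≠ 0) {x : B m n} {p q : ℤ}
    (hpq : |p| ≠ |q|) (h : IsConj (x ^ p) (x ^ q)) :
    ∃ s : ℤ, IsConj (PresentedGroup.of 1 ^ s) x := by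
  have hx : IsConj (equivHNN hm hn x ^ p) (equivHNN hm hn x ^ q) := by
    simpa using (equivHNN hm hn).toMonoidHom.map_isConj h
  obtain ⟨k, hk⟩ := exists_isConj_of_of_stableLength_eq_zero
    (stableLength_eq_zero_of_isConj_zpow _ hpq hx)
  refine ⟨k.toAdd, ?_⟩
  simpa [equivHNN_symm_of] using (equivHNN hm hn).symm.toMonoidHom.map_isConj hk

section AffineAction

variable (hm : m ≠ 0) (hn : n ≠ 0)

/-- The ratio `m / n` as a unit of `ℚ`. -/
def ratio : ℚˣ :=
  Units.mk0 ((m : ℚ) / n) (by positivity)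

/-- The action of `B(m, n)` on `ℚ` by affine maps: `a` multiplies by `m / n` and `b` adds `1`. -/
noncomputable def affineAction : B m n →* (ℚ ≃ᵃ[ℚ] ℚ) :=
  lift (DistribMulAction.toLinearEquiv ℚ ℚ (ratio hm hn)).toAffineEquiv
    (AffineEquiv.constVAdd ℚ ℚ 1) (by
    have hn' : (n : ℚ) ≠ 0 := by exact_mod_cast hn
    rw [mul_assoc, inv_mul_eq_iff_eq_mul, ← AffineEquiv.constVAdd_zsmul,
      ← AffineEquiv.constVAdd_zsmul]
    ext x
    simp only [zsmul_eq_mul, mul_one, ratio, AffineEquiv.coe_mul, LinearEquiv.coe_toAffineEquiv,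
      Function.comp_apply, DistribMulAction.toLinearEquiv_apply, Units.smul_def, Units.val_mk0,
      smul_eq_mul, AffineEquiv.constVAdd_apply, vadd_eq_add]
    field_simp)

theorem affineAction_of_one_zpow (k : ℤ) :
    affineAction hm hn (PresentedGroup.of 1 ^ k) = AffineEquiv.constVAdd ℚ ℚ (k : ℚ) := by
  rw [map_zpow, affineAction, lift_of_one, ← AffineEquiv.constVAdd_zsmul, zsmul_one]

theorem linearHom_comp_affineAction :
    AffineEquiv.linearHom.comp (affineAction hm hn) =
      (DistribMulAction.toModuleAut ℚ ℚ).comp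
        ((zpowersHom ℚˣ (ratio hm hn)).comp (expSum m n)) := by
  apply hom_ext
  · ext
    simp only [MonoidHom.comp_apply, affineAction, lift_of_zero, expSum_of_zero,
      zpowersHom_apply, toAdd_ofAdd, zpow_one]
    rfl
  · ext
    simp [affineAction]

theorem linear_affineAction (g : B m n) (v : ℚ) :
    (affineAction hm hn g).linear v = ((m : ℚ) / n) ^ (expSum m n g).toAdd * v := by
  have h := DFunLike.congr_fun (DFunLike.congr_fun (linearHom_comp_affineAction hm hn) g) v
  simpa [ratio, Units.smul_def] using h

end AffineAction

theorem of_one_ne_one (hm : m ≠ 0) (hn : n ≠ 0) : (PresentedGroup.of 1 : B m n) ≠ 1 := by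
  intro h
  have h0 := DFunLike.congr_fun (affineAction_of_one_zpow hm hn 1) 0
  simp [h] at h0

theorem affineAction_ne_one_of_isConj_zpow (hm : m ≠ 0) (hn : n ≠ 0) {x : B m n} (hx : x ≠ 1)
    {p q : ℤ} (hpq : |p| ≠ |q|) (h : IsConj (x ^ p) (x ^ q)) : affineAction hm hn x ≠ 1 := by
  intro hρ
  obtain ⟨s, hs⟩ := exists_isConj_of_one_zpow hm hn hpq h
  have htriv : affineAction hm hn (PresentedGroup.of 1 ^ s) = 1 := by
    simpa only [hρ, isConj_one_left] using (affineAction hm hn).map_isConj hs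
  rw [affineAction_of_one_zpow] at htriv
  have hs0 : s = 0 := by simpa using DFunLike.congr_fun htriv 0
  rw [hs0, zpow_zero, isConj_one_right] at hs
  exact hx hs

theorem affineAction_eq_constVAdd_of_expSum_eq_one (hm : m ≠ 0) (hn : n ≠ 0) {x : B m n}
    (hx : expSum m n x = 1) :
    affineAction hm hn x = AffineEquiv.constVAdd ℚ ℚ (affineAction hm hn x 0) := by
  ext v
  have h := (affineAction hm hn x).map_vadd 0 v
  rw [vadd_eq_add, add_zero, linear_affineAction, hx] at h
  simpa [add_comm] using h

section Relation

variable {α β : B m n}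

theorem isConj_zpow_of_relation (h : α⁻¹ * β ^ m * α = β ^ n) : IsConj (β ^ m) (β ^ n) :=
  isConj_iff.2 ⟨α⁻¹, by simpa using h⟩

theorem expSum_eq_one_of_relation (hmn : m ≠ n) (h : α⁻¹ * β ^ m * α = β ^ n) :
    expSum m n β = 1 :=
  eq_one_of_isConj_zpow (expSum m n) hmn (isConj_zpow_of_relation h)

theorem div_zpow_expSum_of_relation (hm : m ≠ 0) (hn : n ≠ 0) {v : ℚ} (hv : v ≠ 0)
    (hβ : affineAction hm hn β = AffineEquiv.constVAdd ℚ ℚ v) (h : α⁻¹ * β ^ m * α = β ^ n) :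
    ((m : ℚ) / n) ^ (expSum m n α).toAdd = (m : ℚ) / n := by
  have hβ_zpow (k : ℤ) (x : ℚ) : affineAction hm hn (β ^ k) x = k * v +ᵥ x := by
    rw [map_zpow, hβ, ← AffineEquiv.constVAdd_zsmul, AffineEquiv.constVAdd_apply, zsmul_eq_mul]
  have hrel : β ^ m * α = α * β ^ n := by rw [← h]; group
  have htrans : m * v +ᵥ affineAction hm hn α 0 =
      ((m : ℚ) / n) ^ (expSum m n α).toAdd * (n * v) +ᵥ affineAction hm hn α 0 := by
    calc m * v +ᵥ affineAction hm hn α 0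
        = affineAction hm hn (β ^ m * α) 0 := by
          rw [map_mul, AffineEquiv.coe_mul, Function.comp_apply, hβ_zpow]
      _ = affineAction hm hn α (n * v +ᵥ (0 : ℚ)) := by
          rw [hrel, map_mul, AffineEquiv.coe_mul, Function.comp_apply, hβ_zpow]
      _ = _ := by rw [AffineEquiv.map_vadd, linear_affineAction]
  rw [eq_div_iff (by exact_mod_cast hn)]
  refine mul_right_cancel₀ hv ?_
  rw [mul_assoc]
  exact (vadd_right_cancel _ htrans).symm

theorem expSum_eq_ofAdd_one_of_relation (hmn : |m| ≠ |n|) (hm : m ≠ 0) (hn : n ≠ 0)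
    (h : α⁻¹ * β ^ m * α = β ^ n) (hβ : β ≠ 1) : expSum m n α = Multiplicative.ofAdd 1 := by
  have htrans := affineAction_eq_constVAdd_of_expSum_eq_one hm hn
    (expSum_eq_one_of_relation (fun heq => hmn (congrArg abs heq)) h)
  have hv : affineAction hm hn β 0 ≠ 0 := fun hv =>
    affineAction_ne_one_of_isConj_zpow hm hn hβ hmn (isConj_zpow_of_relation h) <| by
      rw [htrans, hv, AffineEquiv.constVAdd_zero, AffineEquiv.one_def]
  have hratio : |(m : ℚ) / n| ≠ 1 := by
    rw [abs_div, Ne, div_eq_one_iff_eq (by positivity)]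
    exact_mod_cast hmn
  refine Multiplicative.toAdd.injective (zpow_injective_of_abs_ne_one (by positivity) hratio ?_)
  simpa using div_zpow_expSum_of_relation hm hn hv htrans h

end Relation

theorem expSum_comp_eq_of_map_of_one_ne_one (hmn : |m| ≠ |n|) (hm : m ≠ 0) (hn : n ≠ 0)
    {φ : B m n →* B m n} (hφ : φ (PresentedGroup.of 1) ≠ 1) :
    (expSum m n).comp φ = expSum m n := by
  have hrel : (φ (PresentedGroup.of 0))⁻¹ * φ (PresentedGroup.of 1) ^ m *
      φ (PresentedGroup.of 0) = φ (PresentedGroup.of 1) ^ n := by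
    simpa using congrArg φ (inv_of_zero_mul_zpow_mul m n)
  refine hom_ext ?_ ?_
  · rw [MonoidHom.comp_apply, expSum_of_zero]
    exact expSum_eq_ofAdd_one_of_relation hmn hm hn hrel hφ
  · rw [MonoidHom.comp_apply, expSum_of_one]
    exact expSum_eq_one_of_relation (fun heq => hmn (congrArg abs heq)) hrel

end BaumslagSolitar

theorem Coincidence.reidemeisterNumber_eq_top {K G H : Type*} [Group K] [Group G] [CommGroup H]
    [Infinite H] {f g : K →* G} (p : G →* H) (hp : Function.Surjective p)
    (h : p.comp f = p.comp g) : reidemeisterNumber f g = ⊤ := by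
  let q : Quotient (reidemeisterSetoid f g) → H := Quotient.lift p (by
    rintro α _ ⟨τ, rfl⟩
    have hτ : p (f τ) = p (g τ) := DFunLike.congr_fun h τ
    simp [hτ])
  have hq : Function.Surjective q := Quotient.lift_surjective p _ hp
  have := Infinite.of_surjective q hq
  exact ENat.card_eq_top_of_infinite

theorem theorem7p1_general (m n : ℤ) (hmn : |m| ≠ |n|) (h0 : m * n ≠ 0)
    (φ ψ : BaumslagSolitar.B m n →* BaumslagSolitar.B m n)
    (hφ : φ (PresentedGroup.of 1) ≠ 1) (hψ : ψ (PresentedGroup.of 1) ≠ 1) :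
    (BaumslagSolitar.expSum m n).comp φ = BaumslagSolitar.expSum m n ∧
    (BaumslagSolitar.expSum m n).comp ψ = BaumslagSolitar.expSum m n ∧
    Coincidence.reidemeisterNumber φ ψ = ⊤ := by
  obtain ⟨hm, hn⟩ := mul_ne_zero_iff.1 h0
  have hexpφ := BaumslagSolitar.expSum_comp_eq_of_map_of_one_ne_one hmn hm hn hφ
  have hexpψ := BaumslagSolitar.expSum_comp_eq_of_map_of_one_ne_one hmn hm hn hψ
  exact ⟨hexpφ, hexpψ, Coincidence.reidemeisterNumber_eq_top _
    (BaumslagSolitar.expSum_surjective m n) (hexpφ.trans hexpψ.symm)⟩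

theorem theorem7p1 (m n : ℤ) (hmn : |m| ≠ |n|) (h0 : m * n ≠ 0)
    (φ ψ : BaumslagSolitar.B m n →* BaumslagSolitar.B m n)
    (hφ : Function.Injective φ) (hψ : Function.Injective ψ) :
    (BaumslagSolitar.expSum m n).comp φ = BaumslagSolitar.expSum m n ∧
    (BaumslagSolitar.expSum m n).comp ψ = BaumslagSolitar.expSum m n ∧
    Coincidence.reidemeisterNumber φ ψ = ⊤ :=
  have hb := BaumslagSolitar.of_one_ne_one (left_ne_zero_of_mul h0) (right_ne_zero_of_mul h0)
  theorem7p1_general m n hmn h0 φ ψ ((map_ne_one_iff φ hφ).2 hb) ((map_ne_one_iff ψ hψ).2 hb)
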